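/- Let $S$ (suppliers) and $D$ (demanders) be finite sets, let $E\subseteq S\times D$ be a set of edges, and let each edge $(i,j)\in E$ have a capacity $u_{ij}\in[0,\infty]$. For supplies $s\in\mathbb R_{\ge 0}^S$ and demands $d\in\mathbb R_{\ge 0}^D$, a feasible flow is a family $\varphi=(\varphi_{ij})$ of non-negative reals with $\varphi_{ij}\le u_{ij}$ for $(i,j)\in E$, $\varphi_{ij}=0$ for $(i,j)\notin E$, $x_i(\varphi):=\sum_j\varphi_{ij}\le s_i$ for all $i\in S$ and $y_j(\varphi):=\sum_i\varphi_{ij}\le d_j$ for all $j\in D$. A maximum flow is a feasible flow that maximizes $\sum_{i}x_i(\varphi)$ among all feasible flows. A maximum flow $\varphi$ is lex-optimal if, for every other maximum flow $\psi$, when the edge flows $(\varphi_e)_{e\in E}$ and $(\psi_e)_{e\in E}$ are each sorted in increasing order, the two sorted vectors differ and at the first coordinate where they differ the entry of $\varphi$ is the larger one. Each agent $a\in S\cup D$ has a single-peaked preference $R_a$ over her net transfer in $\mathbb R_{\ge 0}$: a complete transitive relation with a peak $p\ge 0$ such that $t<t'\le p$ implies that $t'$ is strictly preferred to $t$, and $p\le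 t<t'$ implies that $t$ is strictly preferred to $t'$. The set $E$ and the capacities $u$ are fixed and known. The edge-fair rule assigns to a reported profile of single-peaked preferences the lex-optimal maximum flow for the supplies and demands given by the reported peaks; the net transfer of a supplier $i$ is then $x_i$ and that of a demander $j$ is $y_j$. A rule is group strategyproof if, for every true profile $R$, every coalition $A\subseteq S\cup D$ and every reported profile $R'$ with $R'_a=R_a$ for all $a\notin A$: if each member $a$ of $A$ finds (according to $R_a$) her net transfer under the report $R'$ at least as good as her net transfer under $R$, then no member of $A$ finds it strictly better. **Corollary.** For all $s\in\mathbb R_{\ge 0}^S$ and $d\in\mathbb R_{\ge 0}^D$ there is exactly one lex-optimal maximum flow, so the edge-fair rule is well defined, and the edge-fair rule is group strategyproof. -/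

import Mathlib

open scoped NNReal ENNReal

/-- A bipartite network between suppliers `S` and demanders `D`: a finite set of edges and, for
each edge, a non-negative, possibly infinite, capacity. -/
structure BipartiteNetwork (S D : Type*) where
  edges : Finset (S × D)
  cap : S → D → ℝ≥0∞

/-- A (non-negative) flow: the amount transferred from each supplier to each demander. -/
abbrev BipartiteFlow (S D : Type*) := S → D → ℝ≥0

/-- Net transfer `x i` of a supplier. Feasible flows vanish off the edges, so the sum over all
demanders is the sum over the demanders linked to `i`. -/
noncomputable def supplierTransfer {S D : Type*} [Fintype D] (φ : BipartiteFlow S D) (i : S) : ℝ≥0 :=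
  ∑ j, φ i j

/-- Net transfer `y j` of a demander. -/
noncomputable def demanderTransfer {S D : Type*} [Fintype S] (φ : BipartiteFlow S D) (j : D) : ℝ≥0 :=
  ∑ i, φ i j

namespace BipartiteNetwork

variable {S D : Type*} [Fintype S] [Fintype D]

/-- Feasible flows for supplies `s` and demands `d`. -/
structure IsFeasible (N : BipartiteNetwork S D) (s : S → ℝ≥0) (d : D → ℝ≥0)
    (φ : BipartiteFlow S D) : Prop where
  eq_zero_off_edges : ∀ i j, (i, j) ∉ N.edges → φ i j = 0
  le_cap : ∀ i j, (i, j) ∈ N.edges → (φ i j : ℝ≥0∞) ≤ N.cap i j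
  le_supply : ∀ i, supplierTransfer φ i ≤ s i
  le_demand : ∀ j, demanderTransfer φ j ≤ d j

/-- Maximum flows: feasible flows of greatest total transfer. -/
structure IsMaxFlow (N : BipartiteNetwork S D) (s : S → ℝ≥0) (d : D → ℝ≥0)
    (φ : BipartiteFlow S D) : Prop where
  feasible : N.IsFeasible s d φ
  total_le : ∀ ψ, N.IsFeasible s d ψ →
    ∑ i, supplierTransfer ψ i ≤ ∑ i, supplierTransfer φ i

/-- The flows on the edges of the network, listed (with multiplicity) in increasing order. -/
noncomputable def sortedFlow (N : BipartiteNetwork S D) (φ : BipartiteFlow S D) : List ℝ≥0 :=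
  (N.edges.val.map fun e => φ e.1 e.2).sort (· ≤ ·)

/-- `φ` lexicographically dominates `ψ`: at the first position `k` where the increasingly sorted
edge flows differ, the entry of `φ` is the larger one. Both lists have one entry per edge. -/
def LexDominates (N : BipartiteNetwork S D) (φ ψ : BipartiteFlow S D) : Prop :=
  ∃ k < N.edges.card,
    (∀ m < k, (N.sortedFlow φ).getD m 0 = (N.sortedFlow ψ).getD m 0) ∧
      (N.sortedFlow ψ).getD k 0 < (N.sortedFlow φ).getD k 0

/-- A lex-optimal maximum flow: it lexicographically dominates all other maximum flows. -/
structure IsLexOptimal (N : BipartiteNetwork S D) (s : S → ℝ≥0) (d : D → ℝ≥0)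
    (φ : BipartiteFlow S D) : Prop where
  maxFlow : N.IsMaxFlow s d φ
  dominates : ∀ ψ, N.IsMaxFlow s d ψ → ψ ≠ φ → N.LexDominates φ ψ

open Classical in
/-- The lex-optimal maximum flow of the problem with supplies `s` and demands `d`. -/
noncomputable def edgeFairFlow (N : BipartiteNetwork S D) (s : S → ℝ≥0) (d : D → ℝ≥0) :
    BipartiteFlow S D :=
  if h : ∃ φ, N.IsLexOptimal s d φ then h.choose else 0

end BipartiteNetwork

/-- A single-peaked preference on `ℝ≥0`: a complete and transitive relation `weak` (`weak a b`
means that `a` is at least as good as `b`) that is strictly increasing up to the peak and strictly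
decreasing beyond it. -/
structure SinglePeaked where
  weak : ℝ≥0 → ℝ≥0 → Prop
  complete : ∀ a b, weak a b ∨ weak b a
  trans : ∀ a b c, weak a b → weak b c → weak a c
  peak : ℝ≥0
  below_peak : ∀ a b, a < b → b ≤ peak → weak b a ∧ ¬ weak a b
  above_peak : ∀ a b, peak ≤ a → a < b → weak a b ∧ ¬ weak b a

/-- Strict preference. -/
def SinglePeaked.strict (R : SinglePeaked) (a b : ℝ≥0) : Prop :=
  R.weak a b ∧ ¬ R.weak b a

/-- Preference profiles: one single-peaked preference per agent. Agents are the suppliers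
and the demanders. -/
abbrev Profile (S D : Type*) := S ⊕ D → SinglePeaked

/-- A mechanism maps reported preference profiles to flows. -/
abbrev Mechanism (S D : Type*) := Profile S D → BipartiteFlow S D

/-- The net transfer of each agent under a flow. -/
noncomputable def allocation {S D : Type*} [Fintype S] [Fintype D] (φ : BipartiteFlow S D) :
    S ⊕ D → ℝ≥0 :=
  Sum.elim (supplierTransfer φ) (demanderTransfer φ)

/-- Group strategyproofness: whatever the true profile `R` and whatever the joint misreport of
a coalition `A` (leading to the reported profile `R'`, which agrees with `R` outside `A`), if every
member of `A` ends up weakly better off according to her true preference, then no member of `A`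
is strictly better off. -/
def GroupStrategyproof {S D : Type*} [Fintype S] [Fintype D] (M : Mechanism S D) : Prop :=
  ∀ (R R' : Profile S D) (A : Set (S ⊕ D)), (∀ a ∉ A, R' a = R a) →
    (∀ a ∈ A, (R a).weak (allocation (M R') a) (allocation (M R) a)) →
      ∀ a ∈ A, ¬ (R a).strict (allocation (M R') a) (allocation (M R) a)

/-- The edge-fair rule: the lex-optimal maximum flow at the reported peaks. -/
noncomputable def edgeFairRule {S D : Type*} [Fintype S] [Fintype D]
    (N : BipartiteNetwork S D) : Mechanism S D :=
  fun R => N.edgeFairFlow (fun i => (R (Sum.inl i)).peak) (fun j => (R (Sum.inr j)).peak)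

/-!
The lex-optimal maximum flow is the *max-min fair* one: no other maximum flow raises the flow on an
edge `f` without lowering the flow on some edge that carries no more than `f`
(`IsMaxMinFair`). A nonempty compact convex set of flows contains a max-min fair element
(`exists_isMaxMinFair`), a max-min fair maximum flow lexicographically dominates every other
maximum flow (`IsMaxMinFair.isLexOptimal`), and lexicographic domination is asymmetric; hence there
is exactly one lex-optimal maximum flow, and it is characterised by max-min fairness.

Max-min fairness is a local notion: it is decided by the maximum flows `(1 - b) φ + b ψ` with
`b > 0` arbitrarily small. Therefore the peak of an agent whose transfer lies strictly below it does
not matter: replacing the peaks of such agents by any other values that are at least their transfers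
leaves the rule's flow unchanged (`IsLexOptimal.of_peaks_changed_at_slack`).

This invariance yields group strategyproofness. Let `z ≤ p` and `z' ≤ p'` be the transfers and peaks
at the true and at the reported profile. A member of the coalition with `z a < p a` who is not worse
off has `p' a ≥ z' a ≥ z a`, and one with `z a = p a` who is not worse off has `z' a = p a`. Let `q`
be the profile of peaks that agrees with `p` where `z a = p a` and with `p'` elsewhere. Both passing
from `p` to `q` and passing from `p'` to `q` change only peaks that lie strictly above the transfer,
and keep them at or above it. So the two flows coincide with the flow at `q`, and nobody gains.
-/

open Filter Topology

/-! ### Lexicographic comparison of sorted lists -/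

theorem Multiset.sort_add_of_le {M L : Multiset ℝ≥0} (h : ∀ a ∈ M, ∀ b ∈ L, a ≤ b) :
    (M + L).sort (· ≤ ·) = M.sort (· ≤ ·) ++ L.sort (· ≤ ·) := by
  apply List.Perm.eq_of_pairwise (le := (· ≤ ·))
  · intro a b _ _ h1 h2
    exact le_antisymm h1 h2
  · exact Multiset.pairwise_sort _ _
  · rw [List.pairwise_append]
    refine ⟨Multiset.pairwise_sort _ _, Multiset.pairwise_sort _ _, fun a ha b hb => ?_⟩
    exact h a (by simpa using ha) b (by simpa using hb)
  · rw [← Multiset.coe_eq_coe, Multiset.sort_eq, ← Multiset.coe_add, Multiset.sort_eq,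
      Multiset.sort_eq]

/-- The smallest entry of the sorted list is at most every element of the multiset. -/
theorem Multiset.sort_getD_zero_le {M : Multiset ℝ≥0} {t : ℝ≥0} (ht : t ∈ M) :
    (M.sort (· ≤ ·)).getD 0 0 ≤ t := by
  have hs : (M.sort (· ≤ ·)).Pairwise (· ≤ ·) := Multiset.pairwise_sort _ _
  have ht' : t ∈ M.sort (· ≤ ·) := by simpa using ht
  revert hs ht'
  cases M.sort (· ≤ ·) with
  | nil => simp
  | cons a l =>
    intro hs ht'
    rcases List.mem_cons.1 ht' with rfl | h
    · rw [List.getD_cons_zero]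
    · rw [List.getD_cons_zero]
      exact (List.pairwise_cons.1 hs).1 t h

theorem Multiset.sort_getD_zero_mem {M : Multiset ℝ≥0} (hM : M ≠ 0) :
    (M.sort (· ≤ ·)).getD 0 0 ∈ M := by
  have h : ∀ a, a ∈ M.sort (· ≤ ·) ↔ a ∈ M := fun a => by simp
  have h0 : M.sort (· ≤ ·) ≠ [] := by
    intro h'
    apply hM
    rw [← Multiset.sort_eq M (· ≤ ·), h']
    rfl
  rw [← h]
  revert h0
  cases M.sort (· ≤ ·) with
  | nil => exact fun h => (h rfl).elim
  | cons a l =>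
    intro _
    rw [List.getD_cons_zero]
    exact List.mem_cons_self

namespace BipartiteNetwork

variable {S D : Type*}

/-- A flow `φ` dominates `ψ` if there is a level `t` such that the two flows agree on the edges where
`φ` is at most `t`, while on the remaining edges `ψ` is at least `t`, with equality somewhere. -/
theorem lexDominates_of_level {N : BipartiteNetwork S D} {φ ψ : BipartiteFlow S D} (t : ℝ≥0)
    (hlow : ∀ e ∈ N.edges, φ e.1 e.2 ≤ t → ψ e.1 e.2 = φ e.1 e.2)
    (hhigh : ∀ e ∈ N.edges, t < φ e.1 e.2 → t ≤ ψ e.1 e.2)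
    (hex : ∃ e ∈ N.edges, t < φ e.1 e.2 ∧ ψ e.1 e.2 = t) : N.LexDominates φ ψ := by
  set P : S × D → Prop := fun e => φ e.1 e.2 ≤ t
  set A := N.edges.val.filter P
  set B := N.edges.val.filter fun e => ¬ P e
  have hAB : A + B = N.edges.val := Multiset.filter_add_not _ _
  have hAψ : A.map (fun e => ψ e.1 e.2) = A.map fun e => φ e.1 e.2 :=
    Multiset.map_congr rfl fun e he =>
      hlow e (Multiset.mem_filter.1 he).1 (Multiset.mem_filter.1 he).2
  have hA : ∀ a ∈ A.map (fun e => φ e.1 e.2), a ≤ t := by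
    intro a ha
    obtain ⟨e, he, rfl⟩ := Multiset.mem_map.1 ha
    exact (Multiset.mem_filter.1 he).2
  have hBφ : ∀ b ∈ B.map (fun e => φ e.1 e.2), t < b := by
    intro a ha
    obtain ⟨e, he, rfl⟩ := Multiset.mem_map.1 ha
    exact not_le.1 (Multiset.mem_filter.1 he).2
  have hBψ : ∀ b ∈ B.map (fun e => ψ e.1 e.2), t ≤ b := by
    intro a ha
    obtain ⟨e, he, rfl⟩ := Multiset.mem_map.1 ha
    exact hhigh e (Multiset.mem_filter.1 he).1 (not_le.1 (Multiset.mem_filter.1 he).2)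
  obtain ⟨e₀, he₀, hφ₀, hψ₀⟩ := hex
  have he₀B : e₀ ∈ B := Multiset.mem_filter.2 ⟨he₀, not_le.2 hφ₀⟩
  have hsφ : N.sortedFlow φ = (A.map fun e => φ e.1 e.2).sort (· ≤ ·) ++
      (B.map fun e => φ e.1 e.2).sort (· ≤ ·) := by
    rw [sortedFlow, ← hAB, Multiset.map_add, Multiset.sort_add_of_le]
    exact fun a ha b hb => (hA a ha).trans (hBφ b hb).le
  have hsψ : N.sortedFlow ψ = (A.map fun e => φ e.1 e.2).sort (· ≤ ·) ++
      (B.map fun e => ψ e.1 e.2).sort (· ≤ ·) := by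
    rw [sortedFlow, ← hAB, Multiset.map_add, hAψ, Multiset.sort_add_of_le]
    exact fun a ha b hb => (hA a ha).trans (hBψ b hb)
  have hlen : ((A.map fun e => φ e.1 e.2).sort (· ≤ ·)).length = A.card := by simp
  refine ⟨A.card, ?_, fun m hm => ?_, ?_⟩
  · have h1 : A.card + B.card = N.edges.card := by rw [← Multiset.card_add, hAB]; rfl
    have h2 : 0 < B.card := Multiset.card_pos_iff_exists_mem.2 ⟨e₀, he₀B⟩
    omega
  · rw [hsφ, hsψ, List.getD_append _ _ _ _ (by omega), List.getD_append _ _ _ _ (by omega)]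
  · rw [hsφ, hsψ, List.getD_append_right _ _ _ _ hlen.le, List.getD_append_right _ _ _ _ hlen.le,
      hlen, Nat.sub_self]
    refine lt_of_le_of_lt (Multiset.sort_getD_zero_le (t := t) ?_)
      (hBφ _ (Multiset.sort_getD_zero_mem ?_))
    · exact Multiset.mem_map.2 ⟨e₀, he₀B, hψ₀⟩
    · rw [Ne, Multiset.map_eq_zero]
      rintro h
      simp [h] at he₀B

theorem LexDominates.asymm {N : BipartiteNetwork S D} {φ ψ : BipartiteFlow S D}
    (h : N.LexDominates φ ψ) : ¬ N.LexDominates ψ φ := by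
  obtain ⟨k, -, hk, hlt⟩ := h
  rintro ⟨l, -, hl, hlt'⟩
  rcases lt_trichotomy k l with h | rfl | h
  · exact hlt.ne (hl k h)
  · exact hlt.not_gt hlt'
  · exact hlt'.ne (hk l h)

/-! ### Max-min fair flows -/

/-- A flow `φ` in the set `K` is max-min fair on the edges `F` if every member of `K` carrying more
than `φ` on some edge `f ∈ F` carries less on an edge of `F` where `φ` is at most its value on `f`. -/
def IsMaxMinFair (F : Finset (S × D)) (K : Set (BipartiteFlow S D)) (φ : BipartiteFlow S D) : Prop :=
  φ ∈ K ∧ ∀ ψ ∈ K, ∀ f ∈ F, φ f.1 f.2 < ψ f.1 f.2 →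
    ∃ e ∈ F, φ e.1 e.2 ≤ φ f.1 f.2 ∧ ψ e.1 e.2 < φ e.1 e.2

/-- The point `(1 - b) x + b y` of a segment lies below any bound `p > x` once `b` is small. -/
theorem eventually_mix_lt {x p : ℝ≥0} (y : ℝ≥0) (h : x < p) :
    ∀ᶠ b in 𝓝[>] (0 : ℝ≥0), (1 - b) * x + b * y < p := by
  have hc : Continuous fun b : ℝ≥0 => (1 - b) * x + b * y := by fun_prop
  have ht := hc.tendsto 0
  simp only [tsub_zero, one_mul, zero_mul, add_zero] at ht
  exact (ht.mono_left nhdsWithin_le_nhds).eventually (gt_mem_nhds h)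

/-- The point `(1 - b) x + b y` of a segment lies above any bound `p < x` once `b` is small. -/
theorem eventually_lt_mix {x p : ℝ≥0} (y : ℝ≥0) (h : p < x) :
    ∀ᶠ b in 𝓝[>] (0 : ℝ≥0), p < (1 - b) * x + b * y := by
  have hc : Continuous fun b : ℝ≥0 => (1 - b) * x + b * y := by fun_prop
  have ht := hc.tendsto 0
  simp only [tsub_zero, one_mul, zero_mul, add_zero] at ht
  exact (ht.mono_left nhdsWithin_le_nhds).eventually (lt_mem_nhds h)

theorem eventually_pos_le_one : ∀ᶠ b in 𝓝[>] (0 : ℝ≥0), 0 < b ∧ b ≤ 1 := by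
  filter_upwards [self_mem_nhdsWithin, nhdsWithin_le_nhds (gt_mem_nhds (zero_lt_one' ℝ≥0))]
    with b h0 h1 using ⟨h0, le_of_lt h1⟩

theorem lt_mix_iff {x y b : ℝ≥0} (hb : 0 < b) (hb1 : b ≤ 1) : x < (1 - b) * x + b * y ↔ x < y := by
  rw [← NNReal.coe_lt_coe, ← NNReal.coe_lt_coe]
  push_cast [NNReal.coe_sub hb1]
  have : (0 : ℝ) < b := hb
  constructor <;> intro h <;> nlinarith

theorem mix_lt_iff {x y b : ℝ≥0} (hb : 0 < b) (hb1 : b ≤ 1) : (1 - b) * x + b * y < x ↔ y < x := by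
  rw [← NNReal.coe_lt_coe, ← NNReal.coe_lt_coe]
  push_cast [NNReal.coe_sub hb1]
  have : (0 : ℝ) < b := hb
  constructor <;> intro h <;> nlinarith

/-- In a nonempty convex set of flows that are at least `l` on `F`, either all members equal `l` on
one and the same edge, or some member exceeds `l` on all of `F`. -/
theorem exists_forall_eq_or_exists_forall_lt {F : Finset (S × D)} {K : Set (BipartiteFlow S D)}
    (hK : Convex ℝ≥0 K) (hne : K.Nonempty) {l : ℝ≥0} (hl : ∀ φ ∈ K, ∀ e ∈ F, l ≤ φ e.1 e.2) :
    (∃ e ∈ F, ∀ φ ∈ K, φ e.1 e.2 = l) ∨ ∃ φ ∈ K, ∀ e ∈ F, l < φ e.1 e.2 := by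
  classical
  by_contra! ⟨h1, h2⟩
  have key : ∀ G ⊆ F, ∃ φ ∈ K, ∀ e ∈ G, l < φ e.1 e.2 := by
    intro G
    induction G using Finset.induction_on with
    | empty => exact fun _ => ⟨hne.some, hne.some_mem, by simp⟩
    | insert g G _ ih =>
      intro hG
      rw [Finset.insert_subset_iff] at hG
      obtain ⟨φ, hφ, hφG⟩ := ih hG.2
      obtain ⟨ψ, hψ, hψg⟩ := h1 g hG.1
      have half : (2⁻¹ : ℝ≥0) + 2⁻¹ = 1 := by
        rw [← two_mul]; exact mul_inv_cancel₀ two_ne_zero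
      have hpos : (0 : ℝ≥0) < 2⁻¹ := by positivity
      have hl2 : l = 2⁻¹ * l + 2⁻¹ * l := by rw [← add_mul, half, one_mul]
      refine ⟨(2⁻¹ : ℝ≥0) • φ + (2⁻¹ : ℝ≥0) • ψ, hK hφ hψ hpos.le hpos.le half, fun e he => ?_⟩
      simp only [Pi.add_apply, Pi.smul_apply, smul_eq_mul]
      rw [hl2]
      rcases Finset.mem_insert.1 he with rfl | he
      · exact add_lt_add_of_le_of_lt (mul_le_mul_right (hl φ hφ e hG.1) _)
          (mul_lt_mul_of_pos_left (lt_of_le_of_ne (hl ψ hψ e hG.1) hψg.symm) hpos)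
      · exact add_lt_add_of_lt_of_le (mul_lt_mul_of_pos_left (hφG e he) hpos)
          (mul_le_mul_right (hl ψ hψ e (hG.2 he)) _)
  obtain ⟨φ, hφ, h⟩ := key F subset_rfl
  obtain ⟨e, he, hle⟩ := h2 φ hφ
  exact (h e he).not_ge hle

/-- A nonempty compact convex set of flows has a max-min fair element. Maximise the smallest value
on `F`; by convexity some edge carries the optimal smallest value in every maximiser, and the
remaining edges are treated in the same way within the set of maximisers. -/
theorem exists_isMaxMinFair (F : Finset (S × D)) {K : Set (BipartiteFlow S D)}
    (hc : IsCompact K) (hK : Convex ℝ≥0 K) (hne : K.Nonempty) : ∃ φ, IsMaxMinFair F K φ := by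
  classical
  induction F using Finset.strongInduction generalizing K with
  | H F ih =>
  rcases F.eq_empty_or_nonempty with rfl | hF
  · exact ⟨hne.some, hne.some_mem, by simp⟩
  have hcont : Continuous fun φ : BipartiteFlow S D => F.inf' hF fun e => φ e.1 e.2 :=
    Continuous.finset_inf'_apply hF fun e _ => by fun_prop
  obtain ⟨φ₀, hφ₀, hmax⟩ := hc.exists_isMaxOn hne hcont.continuousOn
  set l := F.inf' hF fun e => φ₀ e.1 e.2 with hl
  set K' := K ∩ {φ | ∀ e ∈ F, l ≤ φ e.1 e.2} with hK'
  have hφ₀' : φ₀ ∈ K' := ⟨hφ₀, fun e he => Finset.inf'_le _ he⟩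
  have hconv : Convex ℝ≥0 K' := by
    refine hK.inter fun φ hφ ψ hψ a b _ _ hab e he => ?_
    simp only [Pi.add_apply, Pi.smul_apply, smul_eq_mul]
    calc l = a * l + b * l := by rw [← add_mul, hab, one_mul]
      _ ≤ _ := add_le_add (mul_le_mul_right (hφ e he) _) (mul_le_mul_right (hψ e he) _)
  have hcomp : IsCompact K' := by
    refine hc.inter_right ?_
    simp only [Set.ofPred_forall]
    refine isClosed_iInter fun e => isClosed_iInter fun _ => ?_
    exact isClosed_le continuous_const (by fun_prop)
  obtain ⟨e₀, he₀, hpin⟩ : ∃ e ∈ F, ∀ φ ∈ K', φ e.1 e.2 = l := by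
    refine (exists_forall_eq_or_exists_forall_lt hconv ⟨φ₀, hφ₀'⟩
      fun φ hφ => hφ.2).resolve_right ?_
    rintro ⟨φ, hφ, hlt⟩
    exact (hmax hφ.1).not_gt ((Finset.lt_inf'_iff hF).2 hlt)
  obtain ⟨φ, hφ, hfair⟩ := ih _ (Finset.erase_ssubset he₀) hcomp hconv ⟨φ₀, hφ₀'⟩
  refine ⟨φ, hφ.1, fun ψ hψ f hf hlt => ?_⟩
  by_cases hbot : ∃ e ∈ F, φ e.1 e.2 = l ∧ ψ e.1 e.2 < φ e.1 e.2
  · obtain ⟨e, he, hel, hlt'⟩ := hbot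
    exact ⟨e, he, hel.le.trans (hφ.2 f hf), hlt'⟩
  push Not at hbot
  -- No edge at the bottom value is lowered, so a short move from `φ` towards `ψ` stays in `K'`.
  have hev : ∀ᶠ b in 𝓝[>] (0 : ℝ≥0), ∀ e ∈ F, b ≤ 1 → l ≤ (1 - b) * φ e.1 e.2 + b * ψ e.1 e.2 := by
    rw [Filter.eventually_all_finset]
    intro e he
    rcases (hφ.2 e he).eq_or_lt with h | h
    · refine Filter.Eventually.of_forall fun b hb => ?_
      calc l = (1 - b) * l + b * l := by rw [← add_mul, tsub_add_cancel_of_le hb, one_mul]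
        _ ≤ _ := add_le_add (mul_le_mul_right (hφ.2 e he) _)
          (mul_le_mul_right (h.trans_le (hbot e he h.symm)) _)
    · filter_upwards [eventually_lt_mix (ψ e.1 e.2) h] with b hb _ using hb.le
  obtain ⟨b, hb, hb0, hb1⟩ := (hev.and eventually_pos_le_one).exists
  have hmem : (1 - b) • φ + b • ψ ∈ K' :=
    ⟨hK hφ.1 hψ zero_le hb0.le (tsub_add_cancel_of_le hb1), fun e he => hb e he hb1⟩
  have hltmix : φ f.1 f.2 < ((1 - b) • φ + b • ψ) f.1 f.2 := (lt_mix_iff hb0 hb1).2 hlt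
  have hfe : f ≠ e₀ := by
    rintro rfl
    exact hltmix.ne ((hpin φ hφ).trans (hpin _ hmem).symm)
  obtain ⟨e, he, hle, hlt'⟩ := hfair _ hmem f (Finset.mem_erase.2 ⟨hfe, hf⟩) hltmix
  exact ⟨e, (Finset.mem_erase.1 he).2, hle, (mix_lt_iff hb0 hb1).1 hlt'⟩

/-- A max-min fair flow lexicographically dominates the members of `K` that differ from it on an
edge. The level of domination is the smallest value, under either flow, on an edge where the two
flows differ: by fairness it is never attained by `φ` there. -/
theorem IsMaxMinFair.lexDominates {N : BipartiteNetwork S D} {K : Set (BipartiteFlow S D)}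
    {φ ψ : BipartiteFlow S D} (h : IsMaxMinFair N.edges K φ) (hψ : ψ ∈ K)
    (hne : ∃ e ∈ N.edges, ψ e.1 e.2 ≠ φ e.1 e.2) : N.LexDominates φ ψ := by
  classical
  obtain ⟨e₀, he₀, hne₀⟩ := hne
  obtain ⟨g, hg, hmin⟩ := (N.edges.filter fun e => ψ e.1 e.2 ≠ φ e.1 e.2).exists_min_image
    (fun e => min (φ e.1 e.2) (ψ e.1 e.2)) ⟨e₀, Finset.mem_filter.2 ⟨he₀, hne₀⟩⟩
  obtain ⟨hgE, hgne⟩ := Finset.mem_filter.1 hg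
  set t := min (φ g.1 g.2) (ψ g.1 g.2)
  have hmin' : ∀ e ∈ N.edges, ψ e.1 e.2 ≠ φ e.1 e.2 → t ≤ φ e.1 e.2 ∧ t ≤ ψ e.1 e.2 :=
    fun e he hd => le_min_iff.1 (hmin e (Finset.mem_filter.2 ⟨he, hd⟩))
  have hlow : ∀ e ∈ N.edges, φ e.1 e.2 ≤ t → ψ e.1 e.2 = φ e.1 e.2 := by
    intro e he hle
    by_contra hd
    obtain ⟨h1, h2⟩ := hmin' e he hd
    obtain ⟨e', he', hle', hlt⟩ := h.2 ψ hψ e he (lt_of_le_of_ne (hle.trans h2) (Ne.symm hd))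
    exact ((hmin' e' he' hlt.ne).2.trans_lt hlt).not_ge (hle'.trans hle)
  have hgt : t < φ g.1 g.2 := not_le.1 fun hle => hgne (hlow g hgE hle)
  refine lexDominates_of_level t hlow (fun e he hlt => ?_) ⟨g, hgE, hgt, ?_⟩
  · by_cases hd : ψ e.1 e.2 = φ e.1 e.2
    · exact hd ▸ hlt.le
    · exact (hmin' e he hd).2
  · exact ((min_lt_iff.1 hgt).resolve_left (lt_irrefl _)).le |> fun h' => (min_eq_right h').symm

/-! ### The set of maximum flows -/

theorem supplierTransfer_mix [Fintype D] (a b : ℝ≥0) (φ ψ : BipartiteFlow S D) (i : S) :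
    supplierTransfer (a • φ + b • ψ) i = a * supplierTransfer φ i + b * supplierTransfer ψ i := by
  simp [supplierTransfer, Finset.sum_add_distrib, Finset.mul_sum]

theorem demanderTransfer_mix [Fintype S] (a b : ℝ≥0) (φ ψ : BipartiteFlow S D) (j : D) :
    demanderTransfer (a • φ + b • ψ) j = a * demanderTransfer φ j + b * demanderTransfer ψ j := by
  simp [demanderTransfer, Finset.sum_add_distrib, Finset.mul_sum]

variable [Fintype S] [Fintype D] {N : BipartiteNetwork S D} {s : S → ℝ≥0} {d : D → ℝ≥0}
  {φ ψ : BipartiteFlow S D}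

theorem sum_supplierTransfer_mix (a b : ℝ≥0) (φ ψ : BipartiteFlow S D) :
    ∑ i, supplierTransfer (a • φ + b • ψ) i =
      a * ∑ i, supplierTransfer φ i + b * ∑ i, supplierTransfer ψ i := by
  simp [supplierTransfer_mix, Finset.sum_add_distrib, Finset.mul_sum]

theorem mix_le {a b x y p : ℝ≥0} (hab : a + b = 1) (hx : x ≤ p) (hy : y ≤ p) :
    a * x + b * y ≤ p :=
  calc a * x + b * y ≤ a * p + b * p :=
        add_le_add (mul_le_mul_right hx _) (mul_le_mul_right hy _)
    _ = p := by rw [← add_mul, hab, one_mul]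

/-- Edge constraints are preserved under convex combinations, whatever the supplies and demands of
the two flows; the combination is feasible as soon as it respects the peaks. -/
theorem IsFeasible.mix {s' : S → ℝ≥0} {d' : D → ℝ≥0} {s'' : S → ℝ≥0} {d'' : D → ℝ≥0}
    (hφ : N.IsFeasible s d φ) (hψ : N.IsFeasible s' d' ψ) {a b : ℝ≥0} (hab : a + b = 1)
    (hs : ∀ i, a * supplierTransfer φ i + b * supplierTransfer ψ i ≤ s'' i)
    (hd : ∀ j, a * demanderTransfer φ j + b * demanderTransfer ψ j ≤ d'' j) :
    N.IsFeasible s'' d'' (a • φ + b • ψ) where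
  eq_zero_off_edges i j h := by
    simp [hφ.eq_zero_off_edges i j h, hψ.eq_zero_off_edges i j h]
  le_cap i j h := by
    have h1 := hφ.le_cap i j h
    have h2 := hψ.le_cap i j h
    -- the larger of the two edge flows bounds the combination and respects the capacity
    refine le_trans (ENNReal.coe_le_coe.2
      (mix_le (p := max (φ i j) (ψ i j)) hab (le_max_left _ _) (le_max_right _ _))) ?_
    rcases max_choice (φ i j) (ψ i j) with h' | h' <;> rw [h'] <;> assumption
  le_supply i := by rw [supplierTransfer_mix]; exact hs i
  le_demand j := by rw [demanderTransfer_mix]; exact hd j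

theorem convex_setOf_isFeasible : Convex ℝ≥0 {φ | N.IsFeasible s d φ} :=
  fun _ hφ _ hψ _ _ _ _ hab => hφ.mix hψ hab
    (fun i => mix_le hab (hφ.le_supply i) (hψ.le_supply i))
    (fun j => mix_le hab (hφ.le_demand j) (hψ.le_demand j))

theorem isCompact_setOf_isFeasible : IsCompact {φ | N.IsFeasible s d φ} := by
  refine IsCompact.of_isClosed_subset (isCompact_Icc (a := 0) (b := fun i _ => s i)) ?_ ?_
  · have : {φ | N.IsFeasible s d φ} =
        ((⋂ (i) (j) (_ : (i, j) ∉ N.edges), {φ : BipartiteFlow S D | φ i j = 0}) ∩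
          ⋂ (i) (j) (_ : (i, j) ∈ N.edges), {φ : BipartiteFlow S D | (φ i j : ℝ≥0∞) ≤ N.cap i j}) ∩
        ((⋂ i, {φ : BipartiteFlow S D | ∑ j, φ i j ≤ s i}) ∩
          ⋂ j, {φ : BipartiteFlow S D | ∑ i, φ i j ≤ d j}) := by
      ext φ
      simp only [Set.mem_inter_iff, Set.mem_iInter, Set.mem_ofPred_eq]
      exact ⟨fun h => ⟨⟨h.1, h.2⟩, h.3, h.4⟩, fun h => ⟨h.1.1, h.1.2, h.2.1, h.2.2⟩⟩
    rw [this]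
    refine ((isClosed_iInter fun i => isClosed_iInter fun j => isClosed_iInter fun _ =>
      isClosed_eq (by fun_prop) continuous_const).inter
      (isClosed_iInter fun i => isClosed_iInter fun j => isClosed_iInter fun _ =>
      isClosed_le ?_ continuous_const)).inter
      ((isClosed_iInter fun i => isClosed_le (by fun_prop) continuous_const).inter
      (isClosed_iInter fun j => isClosed_le (by fun_prop) continuous_const))
    exact ENNReal.continuous_coe.comp (by fun_prop)
  · intro φ hφ
    refine ⟨fun _ _ => zero_le, fun i j => le_trans ?_ (hφ.le_supply i)⟩
    exact Finset.single_le_sum (f := fun j => φ i j) (fun _ _ => zero_le) (Finset.mem_univ j)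

theorem continuous_sum_supplierTransfer :
    Continuous fun φ : BipartiteFlow S D => ∑ i, supplierTransfer φ i := by
  unfold supplierTransfer
  fun_prop

theorem exists_isMaxFlow : ∃ φ, N.IsMaxFlow s d φ := by
  have h0 : N.IsFeasible s d 0 := by
    constructor <;> simp [supplierTransfer, demanderTransfer]
  obtain ⟨φ, hφ, hmax⟩ := (isCompact_setOf_isFeasible (N := N) (s := s) (d := d)).exists_isMaxOn
    ⟨0, h0⟩ continuous_sum_supplierTransfer.continuousOn
  exact ⟨φ, hφ, fun ψ hψ => hmax hψ⟩

theorem isCompact_setOf_isMaxFlow : IsCompact {φ | N.IsMaxFlow s d φ} := by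
  obtain ⟨φ₀, h₀⟩ := N.exists_isMaxFlow (s := s) (d := d)
  have : {φ | N.IsMaxFlow s d φ} = {φ | N.IsFeasible s d φ} ∩
      {φ | ∑ i, supplierTransfer φ₀ i ≤ ∑ i, supplierTransfer φ i} := by
    ext φ
    exact ⟨fun h => ⟨h.1, h.2 _ h₀.1⟩, fun h => ⟨h.1, fun ψ hψ => (h₀.2 ψ hψ).trans h.2⟩⟩
  rw [this]
  exact isCompact_setOf_isFeasible.inter_right
    (isClosed_le continuous_const continuous_sum_supplierTransfer)

theorem convex_setOf_isMaxFlow : Convex ℝ≥0 {φ | N.IsMaxFlow s d φ} := by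
  intro φ hφ ψ hψ a b ha hb hab
  refine ⟨convex_setOf_isFeasible hφ.1 hψ.1 ha hb hab, fun χ hχ => ?_⟩
  rw [sum_supplierTransfer_mix]
  calc ∑ i, supplierTransfer χ i
      = a * ∑ i, supplierTransfer χ i + b * ∑ i, supplierTransfer χ i := by
        rw [← add_mul, hab, one_mul]
    _ ≤ _ := add_le_add (mul_le_mul_right (hφ.2 χ hχ) _) (mul_le_mul_right (hψ.2 χ hχ) _)

/-! ### Lex-optimal flows are the max-min fair maximum flows -/

theorem IsMaxMinFair.isLexOptimal (h : IsMaxMinFair N.edges {φ | N.IsMaxFlow s d φ} φ) :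
    N.IsLexOptimal s d φ where
  maxFlow := h.1
  dominates ψ hψ hne := by
    refine h.lexDominates hψ ?_
    by_contra! heq
    refine hne (funext fun i => funext fun j => ?_)
    by_cases hij : (i, j) ∈ N.edges
    · exact heq _ hij
    · rw [hψ.1.1 i j hij, h.1.1.1 i j hij]

theorem IsLexOptimal.unique (hφ : N.IsLexOptimal s d φ) (hψ : N.IsLexOptimal s d ψ) : φ = ψ := by
  by_contra hne
  exact (hφ.2 ψ hψ.1 (Ne.symm hne)).asymm (hψ.2 φ hφ.1 hne)

theorem exists_isMaxMinFair_isMaxFlow (N : BipartiteNetwork S D) (s : S → ℝ≥0) (d : D → ℝ≥0) :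
    ∃ φ, IsMaxMinFair N.edges {φ | N.IsMaxFlow s d φ} φ :=
  exists_isMaxMinFair _ isCompact_setOf_isMaxFlow convex_setOf_isMaxFlow exists_isMaxFlow

theorem IsLexOptimal.isMaxMinFair (h : N.IsLexOptimal s d φ) :
    IsMaxMinFair N.edges {φ | N.IsMaxFlow s d φ} φ := by
  obtain ⟨ψ, hψ⟩ := N.exists_isMaxMinFair_isMaxFlow s d
  rwa [h.unique hψ.isLexOptimal]

theorem edgeFairFlow_isLexOptimal (N : BipartiteNetwork S D) (s : S → ℝ≥0) (d : D → ℝ≥0) :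
    N.IsLexOptimal s d (N.edgeFairFlow s d) := by
  have h : ∃ φ, N.IsLexOptimal s d φ :=
    (N.exists_isMaxMinFair_isMaxFlow s d).imp fun _ h => h.isLexOptimal
  rw [edgeFairFlow, dif_pos h]
  exact h.choose_spec

/-! ### Invariance under changes of peaks that do not bind -/

/-- A short move from a transfer `z` towards a transfer `w` that respects a new peak `p'` respects the
old peak `p` if the peak has not changed or did not bind at `z`. -/
theorem eventually_mix_le {z w p p' : ℝ≥0} (hz : z ≤ p) (hw : w ≤ p')
    (h : p' = p ∨ z < p) : ∀ᶠ b in 𝓝[>] (0 : ℝ≥0), (1 - b) * z + b * w ≤ p := by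
  rcases h with rfl | h
  · filter_upwards [eventually_pos_le_one] with b hb
    exact mix_le (tsub_add_cancel_of_le hb.2) hz hw
  · filter_upwards [eventually_mix_lt w h] with b hb using hb.le

/-- The lex-optimal flow does not react to changes of peaks that lie strictly above the transfers,
as long as the new peaks are at least the transfers: a short move from `φ` towards any flow that is
feasible for the new peaks is feasible for the old ones. -/
theorem IsLexOptimal.of_peaks_changed_at_slack {s' : S → ℝ≥0} {d' : D → ℝ≥0}
    (h : N.IsLexOptimal s d φ)
    (hs : ∀ i, s' i = s i ∨ supplierTransfer φ i < s i ∧ supplierTransfer φ i ≤ s' i)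
    (hd : ∀ j, d' j = d j ∨ demanderTransfer φ j < d j ∧ demanderTransfer φ j ≤ d' j) :
    N.IsLexOptimal s' d' φ := by
  obtain ⟨hmax, hfair⟩ := h.isMaxMinFair
  have hfeas : N.IsFeasible s' d' φ :=
    ⟨hmax.1.1, hmax.1.2,
      fun i => (hs i).elim (fun h => h ▸ hmax.1.le_supply i) fun h => h.2,
      fun j => (hd j).elim (fun h => h ▸ hmax.1.le_demand j) fun h => h.2⟩
  have hmix : ∀ ψ, N.IsFeasible s' d' ψ →
      ∃ b : ℝ≥0, 0 < b ∧ b ≤ 1 ∧ N.IsFeasible s d ((1 - b) • φ + b • ψ) := by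
    intro ψ hψ
    have h1 := Filter.eventually_all.2 fun i => eventually_mix_le (hmax.1.le_supply i)
      (hψ.le_supply i) ((hs i).imp_right And.left)
    have h2 := Filter.eventually_all.2 fun j => eventually_mix_le (hmax.1.le_demand j)
      (hψ.le_demand j) ((hd j).imp_right And.left)
    obtain ⟨b, ⟨hb1, hb2⟩, hb, hb'⟩ := ((h1.and h2).and eventually_pos_le_one).exists
    exact ⟨b, hb, hb', hmax.1.mix hψ (tsub_add_cancel_of_le hb') hb1 hb2⟩
  have hmax' : N.IsMaxFlow s' d' φ := by
    refine ⟨hfeas, fun ψ hψ => ?_⟩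
    obtain ⟨b, hb, hb', hmem⟩ := hmix ψ hψ
    have := hmax.2 _ hmem
    rw [sum_supplierTransfer_mix] at this
    by_contra hlt
    exact this.not_gt ((lt_mix_iff hb hb').2 (not_le.1 hlt))
  refine IsMaxMinFair.isLexOptimal ⟨hmax', fun ψ hψ f hf hlt => ?_⟩
  obtain ⟨b, hb, hb', hmem⟩ := hmix ψ hψ.1
  have htot : ∑ i, supplierTransfer ((1 - b) • φ + b • ψ) i = ∑ i, supplierTransfer φ i := by
    rw [sum_supplierTransfer_mix, le_antisymm (hmax'.2 ψ hψ.1) (hψ.2 φ hfeas), ← add_mul,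
      tsub_add_cancel_of_le hb', one_mul]
  obtain ⟨e, he, hle, hlt'⟩ := hfair _ ⟨hmem, fun χ hχ => htot ▸ hmax.2 χ hχ⟩ f hf
    ((lt_mix_iff hb hb').2 hlt)
  exact ⟨e, he, hle, (mix_lt_iff hb hb').1 hlt'⟩

end BipartiteNetwork

/-! ### Group strategyproofness -/

theorem SinglePeaked.le_of_weak {R : SinglePeaked} {z z' : ℝ≥0} (h : R.weak z' z)
    (hz : z ≤ R.peak) : z ≤ z' := by
  by_contra! hlt
  exact (R.below_peak z' z hlt hz).2 h

theorem SinglePeaked.eq_peak_of_weak {R : SinglePeaked} {z' : ℝ≥0} (h : R.weak z' R.peak) :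
    z' = R.peak :=
  le_antisymm (not_lt.1 fun hlt => (R.above_peak _ _ le_rfl hlt).2 h) (R.le_of_weak h le_rfl)

open Classical in
/-- For an agent with true peak `R.peak` and transfer `z`, the peak reported in the intermediate
profile: the true one if it is met by `z`, the announced one otherwise. -/
noncomputable def intermediatePeak (R R' : SinglePeaked) (z : ℝ≥0) : ℝ≥0 :=
  if z = R.peak then R.peak else R'.peak

theorem intermediatePeak_of_true {R R' : SinglePeaked} {z z' : ℝ≥0} (hz : z ≤ R.peak)
    (hz' : z' ≤ R'.peak) (h : R' = R ∨ R.weak z' z) :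
    intermediatePeak R R' z = R.peak ∨ z < R.peak ∧ z ≤ intermediatePeak R R' z := by
  unfold intermediatePeak
  split_ifs with hp
  · exact Or.inl rfl
  · refine Or.inr ⟨lt_of_le_of_ne hz hp, ?_⟩
    rcases h with rfl | h
    · exact hz
    · exact (R.le_of_weak h hz).trans hz'

theorem intermediatePeak_of_reported {R R' : SinglePeaked} {z z' : ℝ≥0}
    (hz' : z' ≤ R'.peak) (h : R' = R ∨ R.weak z' z) :
    intermediatePeak R R' z = R'.peak ∨ z' < R'.peak ∧ z' ≤ intermediatePeak R R' z := by
  unfold intermediatePeak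
  split_ifs with hp
  · rcases h with rfl | h
    · exact Or.inl rfl
    · have hz'p := R.eq_peak_of_weak (hp ▸ h)
      rcases hz'.eq_or_lt with h1 | h1
      · exact Or.inl (hz'p.symm.trans h1)
      · exact Or.inr ⟨h1, hz'p.le⟩
  · exact Or.inl rfl

theorem edgeFairRule_groupStrategyproof {S D : Type*} [Fintype S] [Fintype D]
    (N : BipartiteNetwork S D) : GroupStrategyproof (edgeFairRule N) := by
  intro R R' A hA hweak a _ hstrict
  have h := N.edgeFairFlow_isLexOptimal (fun i => (R (Sum.inl i)).peak)
    fun j => (R (Sum.inr j)).peak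
  have h' := N.edgeFairFlow_isLexOptimal (fun i => (R' (Sum.inl i)).peak)
    fun j => (R' (Sum.inr j)).peak
  have hor : ∀ a, R' a = R a ∨
      (R a).weak (allocation (edgeFairRule N R') a) (allocation (edgeFairRule N R) a) := fun a =>
    (Classical.em (a ∈ A)).symm.imp (hA a) (hweak a)
  have hz := h.maxFlow.feasible
  have hz' := h'.maxFlow.feasible
  set q := fun a => intermediatePeak (R a) (R' a) (allocation (edgeFairRule N R) a)
  have hq := h.of_peaks_changed_at_slack (s' := fun i => q (Sum.inl i))
    (d' := fun j => q (Sum.inr j))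
    (fun i => intermediatePeak_of_true (hz.le_supply i) (hz'.le_supply i) (hor (Sum.inl i)))
    (fun j => intermediatePeak_of_true (hz.le_demand j) (hz'.le_demand j) (hor (Sum.inr j)))
  have hq' := h'.of_peaks_changed_at_slack (s' := fun i => q (Sum.inl i))
    (d' := fun j => q (Sum.inr j))
    (fun i => intermediatePeak_of_reported (hz'.le_supply i) (hor (Sum.inl i)))
    (fun j => intermediatePeak_of_reported (hz'.le_demand j) (hor (Sum.inr j)))
  have heq : edgeFairRule N R = edgeFairRule N R' := hq.unique hq'
  rw [heq] at hstrict
  exact hstrict.2 hstrict.1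

theorem mainTheorem2 {S D : Type*} [Fintype S] [Fintype D] (N : BipartiteNetwork S D) :
    (∀ (s : S → ℝ≥0) (d : D → ℝ≥0), ∃! φ : BipartiteFlow S D, N.IsLexOptimal s d φ) ∧
      GroupStrategyproof (edgeFairRule N) :=
  ⟨fun s d => ⟨_, N.edgeFairFlow_isLexOptimal s d, fun _ h =>
    h.unique (N.edgeFairFlow_isLexOptimal s d)⟩, edgeFairRule_groupStrategyproof N⟩
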